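/- Let $n, k \ge 1$ and let $\mathcal{X} \subset \mathbb{R}^n$ be open. A *non-augmented scalar neural ODE* of class $\mathrm{NODE}^k_{\mathrm N}(\mathcal{X},\mathbb{R})$ is a map $$\Phi : \mathcal{X} \to \mathbb{R}, \qquad \Phi(x) = \widetilde{W}\, h_{Wx+b}(T) + \tilde b ,$$ given by a phase dimension $m \le n$, matrices $W \in \mathbb{R}^{m\times n}$ and $\widetilde W \in \mathbb{R}^{1\times m}$ of full rank ($\operatorname{rank} W = m$, $\operatorname{rank}\widetilde W = 1$), biases $b \in \mathbb{R}^m$ and $\tilde b \in \mathbb{R}$, a time $T \ge 0$, and a vector field $f \in C^{0,k}(\Omega_t\times\Omega_h, \mathbb{R}^m)$ with $\Omega_t \subset \mathbb{R}$ and $\Omega_h \subset \mathbb{R}^m$ open (that is, the derivatives of $f(t,y)$ with respect to $y$ up to order $k$ exist and are continuous in $(t,y)$ on $\Omega_t\times\Omega_h$). Here $h_a : \mathcal{I}_a \to \Omega_h$ is the solution of $\frac{\mathrm{d}h}{\mathrm{d}t} = f(t,h(t))$, $h(0)=a$, on its maximal open interval of existence $\mathcal{I}_a \subset \Omega_t$,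 and it is required that $Wx+b \in \Omega_h$ and $[0,T]\subset \mathcal{I}_{Wx+b}$ for every $x \in \mathcal{X}$. Then no $\Phi \in \mathrm{NODE}^k_{\mathrm N}(\mathcal{X},\mathbb{R})$ has a critical point, i.e. $\nabla\Phi(x) \ne 0$ for all $x \in \mathcal{X}$. Consequently $$\mathrm{NODE}^k_{\mathrm N}(\mathcal{X},\mathbb{R}) \subset (\mathcal{C}1)^k(\mathcal{X},\mathbb{R}) := \{\Psi \in C^k(\mathcal{X},\mathbb{R}) : \nabla \Psi(x) \neq 0 \text{ for all } x \in \mathcal{X}\},$$ and, if $k \ge 2$, every $\Phi \in \mathrm{NODE}^k_{\mathrm N}(\mathcal{X},\mathbb{R})$ is a Morse function, i.e. $\Phi \in C^2(\mathcal{X},\mathbb{R})$ and the Hessian matrix of $\Phi$ is non-singular at every critical point of $\Phi$. -/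

import Mathlib

namespace NeuralODE

/-- The Euclidean space `ℝⁿ`. -/
abbrev E (n : ℕ) : Type := EuclideanSpace ℝ (Fin n)

/-- `f ∈ C^{0,k}(Ωt × Ωh, ℝᵐ)` for open `Ωt`, `Ωh`: for every `t ∈ Ωt` the map `f t` is of class
`C^k` on `Ωh`, and all derivatives of `f` of order `j = 0, …, k` with respect to the second
variable are jointly continuous on `Ωt × Ωh`. -/
def IsC0k {m : ℕ} (k : ℕ) (Ωt : Set ℝ) (Ωh : Set (E m)) (f : ℝ → E m → E m) : Prop :=
  (∀ t ∈ Ωt, ContDiffOn ℝ k (f t) Ωh) ∧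
    ∀ j : ℕ, j ≤ k →
      ContinuousOn (fun p : ℝ × E m => iteratedFDeriv ℝ j (f p.1) p.2) (Ωt ×ˢ Ωh)

/-- `h : I → Ωh` solves `dh/dt = f(t, h(t))`, `h(0) = a`, on the open interval `I ⊆ Ωt`. -/
structure IsSolution {m : ℕ} (Ωt : Set ℝ) (Ωh : Set (E m)) (f : ℝ → E m → E m) (a : E m)
    (I : Set ℝ) (h : ℝ → E m) : Prop where
  isOpen : IsOpen I
  ordConnected : I.OrdConnected
  subset : I ⊆ Ωt
  zero_mem : (0 : ℝ) ∈ I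
  initial : h 0 = a
  mem : ∀ t ∈ I, h t ∈ Ωh
  hasDerivAt : ∀ t ∈ I, HasDerivAt h (f t (h t)) t

/-- `h` is a solution with `h(0) = a` whose interval `I` is the maximal interval of existence:
it has no extension to a solution on a larger open interval. -/
def IsMaximalSolution {m : ℕ} (Ωt : Set ℝ) (Ωh : Set (E m)) (f : ℝ → E m → E m) (a : E m)
    (I : Set ℝ) (h : ℝ → E m) : Prop :=
  IsSolution Ωt Ωh f a I h ∧
    ∀ (J : Set ℝ) (g : ℝ → E m), IsSolution Ωt Ωh f a J g → I ⊆ J → Set.EqOn g h I → J = I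

/-- The data of a scalar neural ODE with input dimension `n` and phase space dimension `m`: the
weights and biases of the two affine layers, the final time, and the vector field on `Ωt × Ωh`. -/
structure Architecture (n m : ℕ) where
  W : Matrix (Fin m) (Fin n) ℝ
  b : E m
  Wout : Matrix (Fin 1) (Fin m) ℝ
  bout : ℝ
  T : ℝ
  Ωt : Set ℝ
  Ωh : Set (E m)
  f : ℝ → E m → E m

/-- The first affine layer `x ↦ W x + b`. -/
noncomputable def Architecture.inLayer {n m : ℕ} (N : Architecture n m) (x : E n) : E m :=
  WithLp.toLp 2 (N.W.mulVec x.ofLp) + N.b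

/-- The second affine layer `y ↦ W̃ y + b̃`. -/
noncomputable def Architecture.outLayer {n m : ℕ} (N : Architecture n m) (y : E m) : ℝ :=
  N.Wout.mulVec y.ofLp 0 + N.bout

/-- The architecture `N` has a `C^{0,k}` vector field, is well defined on `𝒳` (for every
`x ∈ 𝒳` the maximal interval of existence of the solution `h` starting in `W x + b` contains
`[0, T]`), and its input-output map on `𝒳` is `Φ(x) = W̃ h(T) + b̃`. -/
structure Architecture.Realizes {n m : ℕ} (N : Architecture n m) (k : ℕ) (𝒳 : Set (E n))
    (Φ : E n → ℝ) : Prop where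
  isOpen_Ωt : IsOpen N.Ωt
  isOpen_Ωh : IsOpen N.Ωh
  isC0k : IsC0k k N.Ωt N.Ωh N.f
  T_nonneg : 0 ≤ N.T
  output : ∀ x ∈ 𝒳, ∃ (I : Set ℝ) (h : ℝ → E m),
    IsMaximalSolution N.Ωt N.Ωh N.f (N.inLayer x) I h ∧ Set.Icc 0 N.T ⊆ I ∧
      Φ x = N.outLayer (h N.T)

/-- Non-augmented: `m ≤ n`, and both weight matrices have full rank. -/
def Architecture.IsNonAugmented {n m : ℕ} (N : Architecture n m) : Prop :=
  m ≤ n ∧ N.W.rank = m ∧ N.Wout.rank = 1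

/-- The set `NODE_N^k(𝒳, ℝ)` of non-augmented scalar neural ODEs. Its members, like those of the
function classes below, are functions on `𝒳`: their values off `𝒳` play no role. -/
def nodeN {n : ℕ} (k : ℕ) (𝒳 : Set (E n)) : Set (E n → ℝ) :=
  {Φ | ∃ (m : ℕ) (N : Architecture n m), N.IsNonAugmented ∧ N.Realizes k 𝒳 Φ}

/-- The class `(𝒞1)^k(𝒳, ℝ)` of `C^k` functions on the open set `𝒳` without critical points. -/
def classC1 {n : ℕ} (k : ℕ) (𝒳 : Set (E n)) : Set (E n → ℝ) :=
  {Φ | ContDiffOn ℝ k Φ 𝒳 ∧ ∀ x ∈ 𝒳, gradient Φ x ≠ 0}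

/-- The Hessian matrix of `Φ` at `x`. -/
noncomputable def hessian {n : ℕ} (Φ : E n → ℝ) (x : E n) : Matrix (Fin n) (Fin n) ℝ :=
  Matrix.of fun i j =>
    iteratedFDeriv ℝ 2 Φ x ![EuclideanSpace.single i 1, EuclideanSpace.single j 1]

/-- Morse functions on the open set `𝒳`: `C²` functions all of whose critical points are
non-degenerate. -/
def IsMorseOn {n : ℕ} (𝒳 : Set (E n)) (Φ : E n → ℝ) : Prop :=
  ContDiffOn ℝ 2 Φ 𝒳 ∧ ∀ p ∈ 𝒳, gradient Φ p = 0 → (hessian Φ p).det ≠ 0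

end NeuralODE

/-! Near `x`, `Φ` is the affine output layer after the time-`T` flow map after the affine input
layer. The input layer has surjective linear part, the output layer nonzero linear part, and the
flow map has invertible derivative. The chain rule then gives a nonzero derivative, so there are no
critical points and the Morse condition holds vacuously.

The regularity of the flow comes from the inverse function theorem in the Banach space `C([0, T],
V)`. Solutions starting at `a` are the `u` whose `defect`, `u - ∫₀ g(s, u(s)) ds`, is the constant
`a`. The map `defect` is `C^k` because superposition by a `C^{0,k}` family is
(`contDiffOn_superpos`). Its derivative is the identity minus a Volterra operator, hence invertible
(`isUnit_one_sub_primitive_comp`). The local inverse, restricted to constants, is a `C^k` family of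
solutions. By Grönwall these are the given solutions (`injOn_defect`), and backward Grönwall makes
the derivative at time `T` injective (`exists_contDiffAt_solution`). -/

open Set Filter Topology

namespace NeuralODE

/-! ### Continuity of superposition operators -/

section Superposition

variable {K : Type} [TopologicalSpace K]
variable {V F : Type} [NormedAddCommGroup V] [NormedAddCommGroup F]

open Classical in
/-- The superposition operator `u ↦ (t ↦ g(t, u(t)))` on continuous maps (zero if the
composition is not continuous). -/
noncomputable def superpos (g : K → V → F) (u : C(K, V)) : C(K, F) :=
  if h : Continuous fun t => g t (u t) then ⟨_, h⟩ else 0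

theorem superpos_apply {Ω : Set V} {g : K → V → F}
    (hg : ContinuousOn (fun p : K × V => g p.1 p.2) (univ ×ˢ Ω)) {u : C(K, V)}
    (hu : ∀ t, u t ∈ Ω) (t : K) : superpos g u t = g t (u t) := by
  have h : Continuous fun t => g t (u t) :=
    hg.comp_continuous (f := fun t => (t, u t)) (by fun_prop) fun t => ⟨mem_univ _, hu t⟩
  simp [superpos, h]

variable [CompactSpace K]

/-- Uniform continuity of `g` in the second variable along the compact graph of `u`. -/
theorem exists_forall_norm_sub_lt {Ω : Set V} (hΩ : IsOpen Ω) {g : K → V → F}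
    (hg : ContinuousOn (fun p : K × V => g p.1 p.2) (univ ×ˢ Ω)) {u : C(K, V)}
    (hu : ∀ t, u t ∈ Ω) {ε : ℝ} (hε : 0 < ε) :
    ∃ δ > 0, ∀ t, ∀ y ∈ Metric.ball (u t) δ, y ∈ Ω ∧ ‖g t y - g t (u t)‖ < ε := by
  -- Translating by `u` turns its graph into the compact product `K × {0}`, where the tube lemma
  -- gives one `δ` for all `t`.
  set S : Set (K × V) := {p | u p.1 + p.2 ∈ Ω} with hS
  have hSo : IsOpen S := hΩ.preimage (by fun_prop)
  have hc : ContinuousOn (fun p : K × V => ‖g p.1 (u p.1 + p.2) - g p.1 (u p.1)‖) S := by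
    refine ContinuousOn.norm (ContinuousOn.sub ?_ ?_)
    · exact hg.comp (f := fun p : K × V => (p.1, u p.1 + p.2)) (by fun_prop)
        fun p hp => ⟨mem_univ _, hp⟩
    · exact hg.comp (f := fun p : K × V => (p.1, u p.1)) (by fun_prop)
        fun p _ => ⟨mem_univ _, hu _⟩
  have ho := hc.isOpen_inter_preimage hSo (isOpen_Iio (a := ε))
  obtain ⟨A, B, -, hB, hA, h0, hAB⟩ := generalized_tube_lemma (isCompact_univ (X := K))
    (isCompact_singleton (x := (0 : V))) ho (by
      rintro ⟨t, z⟩ ⟨-, hz⟩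
      obtain rfl : z = 0 := hz
      simp [hS, hu, hε])
  obtain ⟨δ, hδ, hball⟩ := Metric.isOpen_iff.1 hB 0 (h0 rfl)
  refine ⟨δ, hδ, fun t y hy => ?_⟩
  have := hAB (show (t, y - u t) ∈ A ×ˢ B from
    ⟨hA (mem_univ _), hball (by simpa [dist_eq_norm] using hy)⟩)
  simpa [hS] using this

theorem isOpen_setOf_forall_mem {Ω : Set V} (hΩ : IsOpen Ω) :
    IsOpen {u : C(K, V) | ∀ t, u t ∈ Ω} := by
  simpa [MapsTo] using ContinuousMap.isOpen_setOfPred_mapsTo (isCompact_univ (X := K)) hΩ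

theorem continuousOn_superpos {Ω : Set V} (hΩ : IsOpen Ω) {g : K → V → F}
    (hg : ContinuousOn (fun p : K × V => g p.1 p.2) (univ ×ˢ Ω)) :
    ContinuousOn (superpos g) {u : C(K, V) | ∀ t, u t ∈ Ω} := by
  intro u hu
  refine ContinuousAt.continuousWithinAt ?_
  rw [Metric.continuousAt_iff]
  intro ε hε
  obtain ⟨δ, hδ, h⟩ := exists_forall_norm_sub_lt hΩ hg hu (half_pos hε)
  refine ⟨δ, hδ, fun {v} hv => ?_⟩
  have hb : ∀ t, v t ∈ Metric.ball (u t) δ := fun t =>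
    (ContinuousMap.dist_apply_le_dist t).trans_lt hv
  refine lt_of_le_of_lt ((ContinuousMap.dist_le (half_pos hε).le).2 fun t => ?_) (half_lt_self hε)
  rw [superpos_apply hg (fun t => (h t _ (hb t)).1), superpos_apply hg hu, dist_eq_norm]
  exact (h t _ (hb t)).2.le

end Superposition

/-! ### Differentiability of superposition operators -/

section SmoothSuperposition

variable {K : Type} [TopologicalSpace K]
variable {V F : Type} [NormedAddCommGroup V] [NormedSpace ℝ V]
  [NormedAddCommGroup F] [NormedSpace ℝ F]

/-- `g(t, y)` is of class `C^k` in `y ∈ Ω`, with `y`-derivatives jointly continuous in `(t, y)`. -/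
def IsC0kFamily (k : ℕ) (Ω : Set V) (g : K → V → F) : Prop :=
  (∀ t, ContDiffOn ℝ k (g t) Ω) ∧
    ∀ j : ℕ, j ≤ k →
      ContinuousOn (fun p : K × V => iteratedFDeriv ℝ j (g p.1) p.2) (univ ×ˢ Ω)

theorem IsC0kFamily.continuousOn {k : ℕ} {Ω : Set V} {g : K → V → F} (hg : IsC0kFamily k Ω g) :
    ContinuousOn (fun p : K × V => g p.1 p.2) (univ ×ˢ Ω) := by
  have h := hg.2 0 (Nat.zero_le _)
  have h2 := (continuousMultilinearCurryFin0 ℝ V F).continuous.comp_continuousOn h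
  refine h2.congr fun p _ => ?_
  simp

theorem IsC0kFamily.fderiv_snd {k : ℕ} {Ω : Set V} (hΩ : IsOpen Ω) {g : K → V → F}
    (hg : IsC0kFamily (k + 1) Ω g) : IsC0kFamily k Ω fun t => fderiv ℝ (g t) := by
  refine ⟨fun t => (hg.1 t).fderiv_of_isOpen hΩ (by simp), fun j hj => ?_⟩
  have h := hg.2 (j + 1) (by omega)
  have h2 := (continuousMultilinearCurryRightEquiv' ℝ j V F).continuous.comp_continuousOn h
  refine h2.congr fun p _ => ?_
  simp [iteratedFDeriv_succ_eq_comp_right]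

theorem IsC0kFamily.of_le {k l : ℕ} {Ω : Set V} {g : K → V → F} (hg : IsC0kFamily k Ω g)
    (hl : l ≤ k) : IsC0kFamily l Ω g :=
  ⟨fun t => (hg.1 t).of_le (by exact_mod_cast hl), fun j hj => hg.2 j (hj.trans hl)⟩

variable [CompactSpace K]

/-- Pointwise application of a continuous family of continuous linear maps. -/
noncomputable def pointwiseApply : C(K, V →L[ℝ] F) →L[ℝ] C(K, V) →L[ℝ] C(K, F) :=
  LinearMap.mkContinuous₂
    (LinearMap.mk₂ ℝ (fun (A : C(K, V →L[ℝ] F)) (v : C(K, V)) =>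
        (⟨fun t => A t (v t), by fun_prop⟩ : C(K, F)))
      (fun _ _ _ => by ext; simp) (fun _ _ _ => by ext; simp)
      (fun _ _ _ => by ext; simp) (fun _ _ _ => by ext; simp)) 1 (by
    intro A v
    refine (ContinuousMap.norm_le _ (by positivity)).2 fun t => ?_
    rw [one_mul]
    exact ((A t).le_opNorm _).trans (mul_le_mul (A.norm_coe_le_norm t) (v.norm_coe_le_norm t)
      (norm_nonneg (v t)) (norm_nonneg A)))

@[simp]
theorem pointwiseApply_apply (A : C(K, V →L[ℝ] F)) (v : C(K, V)) (t : K) :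
    pointwiseApply A v t = A t (v t) := rfl

/-- The mean value inequality bounds the pointwise remainder by `ε ‖v t - u t‖` on a ball whose
radius does not depend on `t`, so the estimate passes to the sup norm. -/
theorem hasFDerivAt_superpos {Ω : Set V} (hΩ : IsOpen Ω) {g : K → V → F}
    (hg : IsC0kFamily 1 Ω g) {u : C(K, V)} (hu : ∀ t, u t ∈ Ω) :
    HasFDerivAt (superpos g) (pointwiseApply (superpos (fun t => fderiv ℝ (g t)) u)) u := by
  have hd : IsC0kFamily 0 Ω fun t => fderiv ℝ (g t) := hg.fderiv_snd hΩ
  rw [hasFDerivAt_iff_isLittleO, Asymptotics.isLittleO_iff]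
  intro ε hε
  obtain ⟨δ, hδ, h⟩ := exists_forall_norm_sub_lt
    (g := fun t => fderiv ℝ (g t)) hΩ hd.continuousOn hu hε
  filter_upwards [Metric.ball_mem_nhds u hδ] with v hv
  have hb : ∀ t, v t ∈ Metric.ball (u t) δ := fun t =>
    (ContinuousMap.dist_apply_le_dist t).trans_lt hv
  refine (ContinuousMap.norm_le _ (by positivity)).2 fun t => ?_
  simp only [ContinuousMap.sub_apply, pointwiseApply_apply]
  rw [superpos_apply hg.continuousOn (fun t => (h t _ (hb t)).1),
    superpos_apply hg.continuousOn hu, superpos_apply hd.continuousOn hu]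
  refine ((convex_ball (u t) δ).norm_image_sub_le_of_norm_fderiv_le' (𝕜 := ℝ)
    (fun y hy => ?_) (fun y hy => (h t y hy).2.le) (Metric.mem_ball_self hδ) (hb t)).trans ?_
  · exact ((hg.1 t).differentiableOn (by simp)).differentiableAt (hΩ.mem_nhds (h t y hy).1)
  · gcongr
    exact (v - u).norm_coe_le_norm t

/-- The derivative is again a superposition operator, for the family `fderiv ℝ (g t)`, followed by a
continuous linear map. The target `F` varies in the induction because that family takes values in `V
→L[ℝ] F`. -/
theorem contDiffOn_superpos (k : ℕ) : ∀ {F : Type} [NormedAddCommGroup F] [NormedSpace ℝ F]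
    {Ω : Set V} (_ : IsOpen Ω) {g : K → V → F} (_ : IsC0kFamily k Ω g),
    ContDiffOn ℝ k (superpos g) {u : C(K, V) | ∀ t, u t ∈ Ω} := by
  induction k with
  | zero =>
    intro F _ _ Ω hΩ g hg
    exact contDiffOn_zero.2 (continuousOn_superpos hΩ hg.continuousOn)
  | succ k ih =>
    intro F _ _ Ω hΩ g hg
    have h1 : ∀ u ∈ {u : C(K, V) | ∀ t, u t ∈ Ω}, HasFDerivAt (superpos g)
        (pointwiseApply (superpos (fun t => fderiv ℝ (g t)) u)) u := fun u hu =>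
      hasFDerivAt_superpos hΩ (hg.of_le (by omega)) hu
    push_cast
    rw [contDiffOn_succ_iff_hasFDerivWithinAt_of_uniqueDiffOn
      (isOpen_setOf_forall_mem hΩ).uniqueDiffOn]
    refine ⟨by simp, _, ?_, fun u hu => (h1 u hu).hasFDerivWithinAt⟩
    exact (pointwiseApply (K := K) (V := V) (F := F)).contDiff.comp_contDiffOn
      (ih hΩ (hg.fderiv_snd hΩ))

end SmoothSuperposition

/-! ### Volterra operators and Grönwall estimates -/

section Primitive

variable {V : Type} [NormedAddCommGroup V] {T : ℝ}

theorem continuous_extend (hT : 0 ≤ T) (g : C(Icc 0 T, V)) : Continuous (IccExtend hT g) :=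
  g.continuous.Icc_extend'

theorem norm_extend_le (hT : 0 ≤ T) (g : C(Icc 0 T, V)) (t : ℝ) :
    ‖IccExtend hT g t‖ ≤ ‖g‖ := g.norm_coe_le_norm _

variable [NormedSpace ℝ V] [CompleteSpace V]

theorem hasDerivAt_integral_extend (hT : 0 ≤ T) (g : C(Icc 0 T, V)) (t : ℝ) :
    HasDerivAt (fun t => ∫ s in (0 : ℝ)..t, IccExtend hT g s) (IccExtend hT g t) t :=
  ((continuous_extend hT g).integral_hasStrictDerivAt 0 t).hasDerivAt

/-- The primitive `t ↦ ∫₀ᵗ g` as an operator on `C([0, T], V)`. -/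
noncomputable def primitive (hT : 0 ≤ T) : C(Icc 0 T, V) →L[ℝ] C(Icc 0 T, V) :=
  LinearMap.mkContinuous
    { toFun := fun g => ⟨fun t => ∫ s in (0 : ℝ)..t, IccExtend hT g s, by
        have : Continuous fun t => ∫ s in (0 : ℝ)..t, IccExtend hT g s :=
          continuous_iff_continuousAt.2 fun t => (hasDerivAt_integral_extend hT g t).continuousAt
        exact this.comp continuous_subtype_val⟩
      map_add' := fun g h => by
        ext t
        exact intervalIntegral.integral_add ((continuous_extend hT g).intervalIntegrable _ _)
          ((continuous_extend hT h).intervalIntegrable _ _)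
      map_smul' := fun c g => by
        ext t
        exact intervalIntegral.integral_smul c _ } T (by
    intro g
    refine (ContinuousMap.norm_le _ (by positivity)).2 fun t => ?_
    refine (intervalIntegral.norm_integral_le_of_norm_le_const
      (fun s _ => norm_extend_le hT g s)).trans ?_
    rw [sub_zero, abs_of_nonneg t.2.1, mul_comm]
    gcongr
    exact t.2.2)

theorem primitive_apply (hT : 0 ≤ T) (g : C(Icc 0 T, V)) (t : Icc 0 T) :
    primitive hT g t = ∫ s in (0 : ℝ)..t, IccExtend hT g s := rfl

/-- Each further integration turns `s ^ n` into `t ^ (n + 1) / (n + 1)`; the resulting factorial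
makes some power of the operator a contraction for every `T`. -/
theorem norm_primitive_pow_apply_le (hT : 0 ≤ T) (A : C(Icc 0 T, V →L[ℝ] V)) (w : C(Icc 0 T, V))
    (n : ℕ) : ∀ t : Icc 0 T, ‖((primitive hT ∘L pointwiseApply A) ^ n) w t‖ ≤
      (‖A‖ * t) ^ n / n.factorial * ‖w‖ := by
  induction n with
  | zero => intro t; simpa using w.norm_coe_le_norm t
  | succ n ih =>
    intro t
    rw [pow_succ', ContinuousLinearMap.mul_def, ContinuousLinearMap.comp_apply,
      ContinuousLinearMap.comp_apply, primitive_apply]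
    set z := ((primitive hT ∘L pointwiseApply A) ^ n) w
    have hb : ∀ s ∈ Ioc (0 : ℝ) t, ‖IccExtend hT (pointwiseApply A z) s‖ ≤
        ‖A‖ ^ (n + 1) / n.factorial * ‖w‖ * s ^ n := by
      intro s hs
      have hsT : s ∈ Icc 0 T := ⟨hs.1.le, hs.2.trans t.2.2⟩
      rw [IccExtend_of_mem hT _ hsT, pointwiseApply_apply]
      refine ((A _).le_opNorm _).trans ?_
      refine (mul_le_mul (A.norm_coe_le_norm _) (ih _) (norm_nonneg _) (norm_nonneg A)).trans
        (le_of_eq ?_)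
      simp only
      ring
    refine (intervalIntegral.norm_integral_le_of_norm_le t.2.1 (Eventually.of_forall hb)
      ((by fun_prop : Continuous fun s : ℝ => ‖A‖ ^ (n + 1) / n.factorial * ‖w‖ * s ^ n
        ).intervalIntegrable _ _)).trans (le_of_eq ?_)
    rw [intervalIntegral.integral_const_mul, integral_pow, Nat.factorial_succ]
    have : (n.factorial : ℝ) ≠ 0 := by positivity
    push_cast
    field_simp
    simp only [ne_eq, Nat.add_eq_zero_iff, one_ne_zero, and_false, not_false_eq_true, zero_pow,
      sub_zero]
    ring

/-- Linear Volterra equations are uniquely solvable. -/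
theorem isUnit_one_sub_primitive_comp (hT : 0 ≤ T) (A : C(Icc 0 T, V →L[ℝ] V)) :
    IsUnit (1 - primitive hT ∘L pointwiseApply A) := by
  set L := primitive hT ∘L pointwiseApply A
  obtain ⟨n, hn⟩ := ((FloorSemiring.tendsto_pow_div_factorial_atTop (‖A‖ * T)).eventually
    (gt_mem_nhds one_pos)).exists
  have hL : ‖L ^ n‖ < 1 := by
    refine lt_of_le_of_lt (ContinuousLinearMap.opNorm_le_bound _ (by positivity) fun w => ?_) hn
    refine (ContinuousMap.norm_le _ (by positivity)).2 fun t => ?_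
    refine (norm_primitive_pow_apply_le hT A w n t).trans ?_
    have := t.2.1
    have := t.2.2
    gcongr
  have hu := isUnit_one_sub_of_norm_lt_one (x := L ^ n) hL
  -- `1 - L ^ n` is the product of the commuting factors `∑ L ^ i` and `1 - L`, so both are units.
  rw [← geom_sum_mul_neg] at hu
  refine (Commute.isUnit_mul_iff ?_).1 hu |>.2
  rw [commute_iff_eq, geom_sum_mul_neg, mul_neg_geom_sum]

/-- Grönwall: if `w = v + ∫₀ q`, `‖q‖ ≤ C ‖w‖` pointwise and `w` vanishes at `0`, then
`w = 0`. -/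
theorem eq_zero_of_left (hT : 0 ≤ T) {w q : C(Icc 0 T, V)} {v : V} {C : ℝ}
    (hw : ∀ t, w t = v + primitive hT q t) (hq : ∀ t, ‖q t‖ ≤ C * ‖w t‖)
    (h0 : w ⟨0, left_mem_Icc.2 hT⟩ = 0) : w = 0 := by
  have hd : ∀ t, HasDerivAt (fun t => v + ∫ s in (0 : ℝ)..t, IccExtend hT q s)
      (IccExtend hT q t) t := fun t => (hasDerivAt_integral_extend hT q t).const_add v
  have key := eq_zero_of_abs_deriv_le_mul_abs_self_of_eq_zero_right (a := 0) (b := T) (K := C)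
    (continuous_iff_continuousAt.2 fun t => (hd t).continuousAt).continuousOn
    (fun t _ => (hd t).hasDerivWithinAt) ?_ ?_
  · ext t
    rw [hw, primitive_apply]
    exact key t t.2
  · rw [← h0, hw, primitive_apply]
  · intro t ht
    have ht' : t ∈ Icc 0 T := Ico_subset_Icc_self ht
    have := hq ⟨t, ht'⟩
    rwa [hw, primitive_apply, ← IccExtend_of_mem hT q ht'] at this

/-- Grönwall backwards in time. -/
theorem eq_zero_of_right (hT : 0 ≤ T) {w q : C(Icc 0 T, V)} {v : V} {C : ℝ}
    (hw : ∀ t, w t = v + primitive hT q t) (hq : ∀ t, ‖q t‖ ≤ C * ‖w t‖)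
    (h0 : w ⟨T, right_mem_Icc.2 hT⟩ = 0) : w = 0 := by
  have hd : ∀ t, HasDerivAt (fun t => v + ∫ s in (0 : ℝ)..(T - t), IccExtend hT q s)
      (-IccExtend hT q (T - t)) t := fun t => by
    have h1 := (hasDerivAt_integral_extend hT q (T - t)).const_add v
    have h2 := h1.scomp t ((hasDerivAt_id t).const_sub T)
    rwa [neg_one_smul] at h2
  have key := eq_zero_of_abs_deriv_le_mul_abs_self_of_eq_zero_right (a := 0) (b := T) (K := C)
    (continuous_iff_continuousAt.2 fun t => (hd t).continuousAt).continuousOn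
    (fun t _ => (hd t).hasDerivWithinAt) ?_ ?_
  · ext t
    rw [hw, primitive_apply]
    have := key (T - t) ⟨by linarith [t.2.2], by linarith [t.2.1]⟩
    rwa [sub_sub_cancel] at this
  · rw [← h0, hw, primitive_apply, sub_zero]
  · intro t ht
    have ht' : T - t ∈ Icc 0 T := ⟨by linarith [ht.2], by linarith [ht.1]⟩
    have := hq ⟨T - t, ht'⟩
    rwa [hw, primitive_apply, ← IccExtend_of_mem hT q ht', ← norm_neg (IccExtend hT q _)] at this

end Primitive

/-! ### Smooth dependence on initial values -/

section Flow

variable {V : Type} [NormedAddCommGroup V] [NormedSpace ℝ V] {T : ℝ}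

/-- A `C¹` family is Lipschitz, uniformly in `t`, between two continuous curves. -/
theorem IsC0kFamily.exists_norm_sub_le {K F : Type} [TopologicalSpace K] [CompactSpace K]
    [NormedAddCommGroup F] [NormedSpace ℝ F] {Ω : Set V} (hΩ : IsOpen Ω) {g : K → V → F}
    (hg : IsC0kFamily 1 Ω g) {u v : C(K, V)} (hu : ∀ t, u t ∈ Ω) (hv : ∀ t, v t ∈ Ω) :
    ∃ C, ∀ t, ‖g t (v t) - g t (u t)‖ ≤ C * ‖v t - u t‖ := by
  have hd : IsC0kFamily 0 Ω fun t => fderiv ℝ (g t) := hg.fderiv_snd hΩ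
  obtain ⟨δ, hδ, h⟩ := exists_forall_norm_sub_lt
    (g := fun t => fderiv ℝ (g t)) hΩ hd.continuousOn hu one_pos
  set A := superpos (fun t => fderiv ℝ (g t)) u
  set M := ‖superpos g v‖ + ‖superpos g u‖
  -- The first term serves where `v t` is within `δ` of `u t`, by the mean value inequality;
  -- elsewhere `M` bounds the difference and `‖v t - u t‖ ≥ δ`.
  refine ⟨(1 + ‖A‖) + M / δ, fun t => ?_⟩
  rw [add_mul]
  by_cases ht : v t ∈ Metric.ball (u t) δ
  · refine ((convex_ball (u t) δ).norm_image_sub_le_of_norm_fderiv_le (𝕜 := ℝ) (C := 1 + ‖A‖)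
      (fun y hy => ?_) (fun y hy => ?_) (Metric.mem_ball_self hδ) ht).trans
      (le_add_of_nonneg_right (by positivity))
    · exact ((hg.1 t).differentiableOn (by simp)).differentiableAt (hΩ.mem_nhds (h t y hy).1)
    · have h1 := A.norm_coe_le_norm t
      rw [superpos_apply hd.continuousOn hu] at h1
      have h2 := norm_le_norm_sub_add (fderiv ℝ (g t) y) (fderiv ℝ (g t) (u t))
      linarith [(h t y hy).2]
  · have hδ' : δ ≤ ‖v t - u t‖ := by simpa [dist_eq_norm] using ht
    have hM : ‖g t (v t) - g t (u t)‖ ≤ M := by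
      rw [← superpos_apply hg.continuousOn hv, ← superpos_apply hg.continuousOn hu]
      exact (norm_sub_le _ _).trans
        (add_le_add ((superpos g v).norm_coe_le_norm t) ((superpos g u).norm_coe_le_norm t))
    refine hM.trans (le_trans ?_ (le_add_of_nonneg_left (by positivity)))
    calc M = M / δ * δ := by field_simp
      _ ≤ _ := by gcongr

variable [CompleteSpace V]

/-- The defect `u - ∫₀ g(s, u(s)) ds`; it is constant, equal to `a`, exactly for the solutions
of the integral equation with initial value `a`. -/
noncomputable def defect (hT : 0 ≤ T) (g : Icc 0 T → V → V) (u : C(Icc 0 T, V)) :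
    C(Icc 0 T, V) :=
  u - primitive hT (superpos g u)

/-- If the defects agree, `v - u` is a primitive vanishing at `0` whose integrand is bounded by a
multiple of `‖v - u‖`, so Grönwall applies. -/
theorem injOn_defect (hT : 0 ≤ T) {Ω : Set V} (hΩ : IsOpen Ω) {g : Icc 0 T → V → V}
    (hg : IsC0kFamily 1 Ω g) : InjOn (defect hT g) {u | ∀ t, u t ∈ Ω} := by
  intro v hv u hu h
  obtain ⟨C, hC⟩ := hg.exists_norm_sub_le hΩ hu hv
  have hsub : v - u = primitive hT (superpos g v - superpos g u) := by
    rw [map_sub]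
    unfold defect at h
    rw [sub_eq_sub_iff_add_eq_add] at h ⊢
    rw [h, add_comm]
  refine sub_eq_zero.1 (eq_zero_of_left hT (v := 0) (C := C)
    (q := superpos g v - superpos g u) (fun t => ?_) (fun t => ?_) ?_)
  · rw [hsub, zero_add]
  · rw [ContinuousMap.sub_apply, superpos_apply hg.continuousOn hv,
      superpos_apply hg.continuousOn hu]
    exact hC t
  · rw [hsub, primitive_apply]
    simp

theorem hasFDerivAt_defect (hT : 0 ≤ T) {Ω : Set V} (hΩ : IsOpen Ω) {g : Icc 0 T → V → V}
    (hg : IsC0kFamily 1 Ω g) {u : C(Icc 0 T, V)} (hu : ∀ t, u t ∈ Ω) :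
    HasFDerivAt (defect hT g)
      (1 - primitive hT ∘L pointwiseApply (superpos (fun t => fderiv ℝ (g t)) u)) u :=
  (hasFDerivAt_id u).sub (HasFDerivAt.comp (g := primitive hT) u (primitive (V := V) hT).hasFDerivAt
    (hasFDerivAt_superpos hΩ hg hu))

theorem contDiffAt_defect (hT : 0 ≤ T) {k : ℕ} {Ω : Set V} (hΩ : IsOpen Ω)
    {g : Icc 0 T → V → V} (hg : IsC0kFamily k Ω g) {u : C(Icc 0 T, V)} (hu : ∀ t, u t ∈ Ω) :
    ContDiffAt ℝ k (defect hT g) u :=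
  contDiffAt_id.sub (ContDiffAt.comp (g := primitive hT) u (primitive (V := V) hT).contDiff.contDiffAt
    ((contDiffOn_superpos k hΩ hg).contDiffAt ((isOpen_setOf_forall_mem hΩ).mem_nhds hu)))

/-- The constant functions, as a continuous linear map. -/
noncomputable def constCLM (K V : Type) [TopologicalSpace K] [CompactSpace K]
    [NormedAddCommGroup V] [NormedSpace ℝ V] : V →L[ℝ] C(K, V) :=
  LinearMap.mkContinuous
    { toFun := ContinuousMap.const K, map_add' := fun _ _ => rfl, map_smul' := fun _ _ => rfl } 1
    fun v => (ContinuousMap.norm_le _ (by positivity)).2 fun _ => (one_mul ‖v‖).ge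

@[simp]
theorem constCLM_apply {K V : Type} [TopologicalSpace K] [CompactSpace K]
    [NormedAddCommGroup V] [NormedSpace ℝ V] (v : V) (t : K) : constCLM K V v t = v := rfl

/-- Smooth dependence of solutions on the initial value: a `C^k` local family of solutions of the
integral equation, for which the derivative of the time-`T` map is injective. -/
theorem exists_contDiffAt_solution (hT : 0 ≤ T) {k : ℕ} (hk : 1 ≤ k) {Ω : Set V} (hΩ : IsOpen Ω)
    {g : Icc 0 T → V → V} (hg : IsC0kFamily k Ω g) {u : C(Icc 0 T, V)} (hu : ∀ t, u t ∈ Ω)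
    {a : V} (ha : defect hT g u = constCLM _ V a) :
    ∃ φ : V → C(Icc 0 T, V), ContDiffAt ℝ k φ a ∧
      (∀ᶠ b in 𝓝 a, (∀ t, φ b t ∈ Ω) ∧ defect hT g (φ b) = constCLM _ V b) ∧
      ∀ v, fderiv ℝ φ a v ⟨T, right_mem_Icc.2 hT⟩ = 0 → v = 0 := by
  have hg1 : IsC0kFamily 1 Ω g := hg.of_le hk
  have hk0 : (k : WithTop ℕ∞) ≠ 0 := by exact_mod_cast (by omega : k ≠ 0)
  set A := superpos (fun t => fderiv ℝ (g t)) u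
  have hD := hasFDerivAt_defect hT hΩ hg1 hu
  have hc := contDiffAt_defect hT hΩ hg hu
  obtain ⟨e, he⟩ : ∃ e : C(Icc 0 T, V) ≃L[ℝ] C(Icc 0 T, V),
      (e : C(Icc 0 T, V) →L[ℝ] C(Icc 0 T, V)) = 1 - primitive hT ∘L pointwiseApply A := by
    obtain ⟨U, hU⟩ := isUnit_one_sub_primitive_comp hT A
    exact ⟨ContinuousLinearEquiv.unitsEquiv ℝ _ U, hU⟩
  have hD' : HasFDerivAt (defect hT g) (e : C(Icc 0 T, V) →L[ℝ] C(Icc 0 T, V)) u := he ▸ hD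
  set ψ := hc.localInverse hD' hk0
  have hψu : ψ (constCLM _ V a) = u := by
    rw [← ha]; exact hc.localInverse_apply_image hD' hk0
  have hψc : ContDiffAt ℝ k ψ (constCLM _ V a) := by
    rw [← ha]; exact hc.to_localInverse hD' hk0
  have hφc : ContDiffAt ℝ k (fun b => ψ (constCLM _ V b)) a :=
    hψc.comp a (constCLM (Icc 0 T) V).contDiff.contDiffAt
  have hright : ∀ᶠ b in 𝓝 a, defect hT g (ψ (constCLM _ V b)) = constCLM _ V b := by
    have h1 : ∀ᶠ y in 𝓝 (defect hT g u), defect hT g (ψ y) = y :=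
      (hc.hasStrictFDerivAt' hD' hk0).eventually_right_inverse
    rw [ha] at h1
    exact (constCLM (Icc 0 T) V).continuous.continuousAt.eventually h1
  refine ⟨fun b => ψ (constCLM _ V b), hφc, ?_, fun v hv => ?_⟩
  · refine Eventually.and ?_ hright
    refine hφc.continuousAt.eventually ((isOpen_setOf_forall_mem hΩ).mem_nhds ?_)
    simpa [hψu] using hu
  · set φ := fun b => ψ (constCLM _ V b)
    set w := fderiv ℝ φ a v with hw
    have hφd : HasFDerivAt φ (fderiv ℝ φ a) a := (hφc.differentiableAt hk0).hasFDerivAt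
    have hφa : φ a = u := hψu
    -- Differentiating `defect (φ b) = b` in two ways gives the variational equation `w = v + ∫₀ A
    -- w`.
    have h1 : HasFDerivAt (fun b => defect hT g (φ b))
        ((1 - primitive hT ∘L pointwiseApply A) ∘L fderiv ℝ φ a) a :=
      HasFDerivAt.comp (g := defect hT g) a (hφa.symm ▸ hD) hφd
    have h2 : HasFDerivAt (fun b => defect hT g (φ b)) (constCLM (Icc 0 T) V) a :=
      (constCLM (Icc 0 T) V).hasFDerivAt.congr_of_eventuallyEq hright
    have h3 := DFunLike.congr_fun (h1.unique h2) v
    have h4 : ∀ t, w t = v + primitive hT (pointwiseApply A w) t := fun t => by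
      have := DFunLike.congr_fun h3 t
      simp only [ContinuousLinearMap.comp_apply, sub_apply,
        one_apply_eq_self, ContinuousMap.sub_apply, constCLM_apply, ← hw] at this
      rw [← this]
      abel
    have h5 : w = 0 := eq_zero_of_right hT h4 (C := ‖A‖) (fun t => by
      rw [pointwiseApply_apply]
      refine ((A t).le_opNorm _).trans ?_
      gcongr
      exact A.norm_coe_le_norm t) hv
    -- At time `0` the integral vanishes, so the equation reads `0 = v`.
    have h6 := h4 ⟨0, left_mem_Icc.2 hT⟩
    rw [h5, primitive_apply] at h6
    simpa using h6.symm

end Flow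

theorem IsC0k.isC0kFamily {m k : ℕ} {T : ℝ} {Ωt : Set ℝ} {Ωh : Set (E m)} {f : ℝ → E m → E m}
    (hf : IsC0k k Ωt Ωh f) (hT : Icc 0 T ⊆ Ωt) :
    IsC0kFamily k Ωh fun (t : Icc 0 T) y => f t y :=
  ⟨fun t => hf.1 t (hT t.2), fun j hj => (hf.2 j hj).comp
    (f := fun p : Icc 0 T × E m => ((p.1 : ℝ), p.2)) (by fun_prop) fun p hp => ⟨hT p.1.2, hp.2⟩⟩

/-- Solutions of the differential equation solve the integral equation. -/
theorem IsSolution.exists_defect_eq {m k : ℕ} {T : ℝ} {Ωt : Set ℝ} {Ωh : Set (E m)}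
    {f : ℝ → E m → E m} {a : E m} {I : Set ℝ} {h : ℝ → E m} (hs : IsSolution Ωt Ωh f a I h)
    (hf : IsC0k k Ωt Ωh f) (hT : 0 ≤ T) (hI : Icc 0 T ⊆ I) :
    ∃ u : C(Icc 0 T, E m), (∀ t, u t ∈ Ωh) ∧ (∀ t, u t = h t) ∧
      defect hT (fun t y => f t y) u = constCLM _ _ a := by
  have hg := hf.isC0kFamily (hI.trans hs.subset)
  have hc : ContinuousOn h (Icc 0 T) := fun t ht =>
    (hs.hasDerivAt t (hI ht)).continuousAt.continuousWithinAt
  set u : C(Icc 0 T, E m) := ⟨fun t => h t, hc.domRestrict⟩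
  have hu : ∀ t, u t ∈ Ωh := fun t => hs.mem t (hI t.2)
  refine ⟨u, hu, fun _ => rfl, ?_⟩
  ext1 t
  change h t - primitive hT _ t = a
  rw [primitive_apply, intervalIntegral.integral_eq_sub_of_hasDerivAt (f := h), hs.initial,
    sub_sub_cancel]
  · intro s hst
    rw [uIcc_of_le t.2.1] at hst
    have hsT : s ∈ Icc 0 T := ⟨hst.1, hst.2.trans t.2.2⟩
    rw [IccExtend_of_mem hT _ hsT, superpos_apply hg.continuousOn hu]
    exact hs.hasDerivAt s (hI hsT)
  · exact (continuous_extend hT _).intervalIntegrable _ _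

/-! ### The affine layers and the input-output map -/

section Layers

variable {n m : ℕ} (N : Architecture n m)

/-- The linear part of the first layer. -/
noncomputable def Architecture.inCLM : E n →L[ℝ] E m :=
  LinearMap.toContinuousLinearMap (Matrix.toEuclideanLin N.W)

theorem Architecture.inLayer_eq (x : E n) : N.inLayer x = N.inCLM x + N.b := rfl

/-- The linear part of the second layer. -/
noncomputable def Architecture.outCLM : E m →L[ℝ] ℝ :=
  LinearMap.toContinuousLinearMap
    (LinearMap.proj 0 ∘ₗ N.Wout.mulVecLin ∘ₗ (WithLp.linearEquiv 2 ℝ (Fin m → ℝ)).toLinearMap)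

theorem Architecture.outLayer_eq (y : E m) : N.outLayer y = N.outCLM y + N.bout := rfl

theorem Architecture.surjective_inCLM (h : N.W.rank = m) : Function.Surjective N.inCLM := by
  have hr : LinearMap.range N.W.mulVecLin = ⊤ :=
    Submodule.eq_top_of_finrank_eq (by rw [Module.finrank_fin_fun]; exact h)
  intro y
  obtain ⟨x, hx⟩ := LinearMap.range_eq_top.1 hr y.ofLp
  exact ⟨WithLp.toLp 2 x, congrArg (WithLp.toLp 2) hx⟩

theorem Architecture.exists_outCLM_ne_zero (h : N.Wout.rank = 1) : ∃ y, N.outCLM y ≠ 0 := by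
  by_contra! h0
  have : N.Wout = 0 := by
    ext i j
    obtain rfl := Subsingleton.elim i 0
    have := h0 (EuclideanSpace.single j 1)
    change N.Wout.mulVec (Pi.single j 1) 0 = 0 at this
    simpa using this
  rw [this, Matrix.rank_zero] at h
  exact zero_ne_one h

/-- The input-output map of a non-augmented scalar neural ODE is of class `C^k` and regular. -/
theorem Architecture.Realizes.contDiffAt_and_fderiv_ne_zero {N : Architecture n m} {k : ℕ}
    (hk : 1 ≤ k) {𝒳 : Set (E n)} (h𝒳 : IsOpen 𝒳) {Φ : E n → ℝ} (hN : N.IsNonAugmented)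
    (hΦ : N.Realizes k 𝒳 Φ) {x : E n} (hx : x ∈ 𝒳) :
    ContDiffAt ℝ k Φ x ∧ fderiv ℝ Φ x ≠ 0 := by
  have hT := hΦ.T_nonneg
  have hsol : ∀ z ∈ 𝒳, ∃ u : C(Icc 0 N.T, E m), (∀ t, u t ∈ N.Ωh) ∧
      defect hT (fun t y => N.f t y) u = constCLM _ _ (N.inLayer z) ∧
      Φ z = N.outCLM (u ⟨N.T, right_mem_Icc.2 hT⟩) + N.bout := fun z hz => by
    obtain ⟨I, h, hmax, hI, hout⟩ := hΦ.output z hz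
    obtain ⟨u, hu, huh, hd⟩ := hmax.1.exists_defect_eq hΦ.isC0k hT hI
    exact ⟨u, hu, hd, by rw [hout, huh, N.outLayer_eq]⟩
  have hg : IsC0kFamily k N.Ωh fun (t : Icc 0 N.T) y => N.f t y := by
    obtain ⟨I, h, hmax, hI, -⟩ := hΦ.output x hx
    exact hΦ.isC0k.isC0kFamily (hI.trans hmax.1.subset)
  obtain ⟨u, hu, hd, -⟩ := hsol x hx
  obtain ⟨φ, hφc, hφ, hinj⟩ := exists_contDiffAt_solution hT hk hΦ.isOpen_Ωh hg hu hd
  have hk0 : (k : WithTop ℕ∞) ≠ 0 := by exact_mod_cast (by omega : k ≠ 0)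
  have hin : HasFDerivAt N.inLayer N.inCLM x := N.inCLM.hasFDerivAt.add_const N.b
  have hinc : ContDiffAt ℝ k N.inLayer x := N.inCLM.contDiff.contDiffAt.add contDiffAt_const
  set L : C(Icc 0 N.T, E m) →L[ℝ] E m := ContinuousMap.evalCLM ℝ ⟨N.T, right_mem_Icc.2 hT⟩
  have heq : Φ =ᶠ[𝓝 x] fun z => N.outCLM (L (φ (N.inLayer z))) + N.bout := by
    filter_upwards [h𝒳.mem_nhds hx, hin.continuousAt.eventually hφ] with z hz ⟨hz1, hz2⟩
    obtain ⟨v, hv, hvd, hvΦ⟩ := hsol z hz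
    -- Uniqueness identifies the solution chosen for `z` with the smooth family `φ`.
    rw [hvΦ, injOn_defect hT hΦ.isOpen_Ωh (hg.of_le hk) hv hz1 (hvd.trans hz2.symm)]
    rfl
  refine ⟨ContDiffAt.congr_of_eventuallyEq ?_ heq, fun h0 => ?_⟩
  · exact ((N.outCLM.contDiff.comp L.contDiff).contDiffAt.comp x
      (hφc.comp x hinc)).add contDiffAt_const
  · have hφd := (hφc.differentiableAt hk0).hasFDerivAt
    have hder : HasFDerivAt (fun z => N.outCLM (L (φ (N.inLayer z))) + N.bout)
        ((N.outCLM ∘L L) ∘L (fderiv ℝ φ (N.inLayer x) ∘L N.inCLM)) x :=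
      ((N.outCLM ∘L L).hasFDerivAt.comp x (hφd.comp x hin)).add_const _
    rw [heq.fderiv_eq, hder.fderiv] at h0
    obtain ⟨y, hy⟩ := N.exists_outCLM_ne_zero hN.2.2
    have hLinj : Function.Injective ((L ∘L fderiv ℝ φ (N.inLayer x) : E m →L[ℝ] E m) :
        E m →ₗ[ℝ] E m) := (injective_iff_map_eq_zero _).2 hinj
    -- An injective endomorphism of `E m` is onto, so a vector not killed by the output layer can be
    -- pulled back to the input space.
    obtain ⟨v, rfl⟩ := LinearMap.injective_iff_surjective.1 hLinj y
    obtain ⟨z, rfl⟩ := N.surjective_inCLM hN.2.1 v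
    exact hy (DFunLike.congr_fun h0 z)

end Layers

end NeuralODE

theorem mainTheorem4 (n k : ℕ) (hk : 1 ≤ k) (𝒳 : Set (NeuralODE.E n)) (h𝒳 : IsOpen 𝒳) :
    (∀ Φ ∈ NeuralODE.nodeN k 𝒳, ∀ x ∈ 𝒳, gradient Φ x ≠ 0) ∧
      NeuralODE.nodeN k 𝒳 ⊆ NeuralODE.classC1 k 𝒳 ∧
      (2 ≤ k → ∀ Φ ∈ NeuralODE.nodeN k 𝒳, NeuralODE.IsMorseOn 𝒳 Φ) := by
  have key : ∀ Φ ∈ NeuralODE.nodeN k 𝒳, ∀ x ∈ 𝒳, ContDiffAt ℝ k Φ x ∧ fderiv ℝ Φ x ≠ 0 := by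
    rintro Φ ⟨m, N, hN, hΦ⟩ x hx
    exact hΦ.contDiffAt_and_fderiv_ne_zero hk h𝒳 hN hx
  have hgrad : ∀ Φ ∈ NeuralODE.nodeN k 𝒳, ∀ x ∈ 𝒳, gradient Φ x ≠ 0 := fun Φ hΦ x hx h0 =>
    (key Φ hΦ x hx).2 (by simpa [gradient] using h0)
  have hsmooth : ∀ Φ ∈ NeuralODE.nodeN k 𝒳, ContDiffOn ℝ k Φ 𝒳 := fun Φ hΦ x hx =>
    (key Φ hΦ x hx).1.contDiffWithinAt
  exact ⟨hgrad, fun Φ hΦ => ⟨hsmooth Φ hΦ, hgrad Φ hΦ⟩, fun h2 Φ hΦ =>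
    ⟨(hsmooth Φ hΦ).of_le (by exact_mod_cast h2), fun p hp h0 => absurd h0 (hgrad Φ hΦ p hp)⟩⟩
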